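/- Let $\mathbb K$ be a field, $(A,\mu,\alpha)$ a multiplicative Hom-associative $\mathbb K$-algebra (that is, $\mu(a,b)=a\cdot b$ is bilinear, $\alpha$ is linear, $\alpha(a)\cdot(b\cdot c)=(a\cdot b)\cdot\alpha(c)$ and $\alpha(a\cdot b)=\alpha(a)\cdot\alpha(b)$), and $(M,l,r,\phi)$ an $A$-bimodule: $l:A\otimes M\to M$, $r:M\otimes A\to M$ and $\phi:M\to M$ are linear with $\phi\, l(x,v)=l(\alpha(x),\phi(v))$, $\phi\, r(v,x)=r(\phi(v),\alpha(x))$, $l(x\cdot y,\phi(v))=l(\alpha(x),l(y,v))$, $r(\phi(v),x\cdot y)=r(r(v,x),\alpha(y))$ and $l(\alpha(x),r(v,y))=r(l(x,v),\alpha(y))$. Let $T:M\to A$ be an $\mathcal O$-operator: a linear map with $T\phi=\alpha T$ and $T(u)\cdot T(v)=T\big(l(T(u),v)+r(u,T(v))\big)$ for all $u,v\in M$. For $n\ge 1$ let $C^n(M,A)$ be the space of $n$-linear maps $f:M^n\to A$ with $\alpha(f(u_1,\dots,u_n))=f(\phi(u_1),\dots,\phi(u_n))$. Put $u\star_T v=r(u,T(v))+l(T(u),v)$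 and define $d_H:C^n(M,A)\to C^{n+1}(M,A)$ by $$\begin{aligned}(d_Hf)(u_1,\dots,u_{n+1})={}&T(\phi^{n-1}(u_1))\cdot f(u_2,\dots,u_{n+1})-T\big(r(\phi^{n-1}(u_1),f(u_2,\dots,u_{n+1}))\big)\\&+\sum_{i=1}^n(-1)^i f(\phi(u_1),\dots,\phi(u_{i-1}),u_i\star_T u_{i+1},\phi(u_{i+2}),\dots,\phi(u_{n+1}))\\&+(-1)^{n+1}\Big(f(u_1,\dots,u_n)\cdot T(\phi^{n-1}(u_{n+1}))-T\big(l(f(u_1,\dots,u_n),\phi^{n-1}(u_{n+1}))\big)\Big).\end{aligned}$$ Let $Z^n(M,A)=\ker\big(d_H:C^n\to C^{n+1}\big)$ for $n\ge1$, and for $n\ge 2$ let $B^n(M,A)=d_H(C^{n-1}(M,A))$ and $H^n(M,A)=Z^n(M,A)/B^n(M,A)$. An *order $n$ deformation* of $T$ ($n\ge 0$) is $T_t=T+\sum_{i=1}^n t^iT_i$ with $T_i\in C^1(M,A)$ such that $T_t(u)\cdot T_t(v)\equiv T_t\big(l(T_t(u),v)+r(u,T_t(v))\big) \pmod{t^{n+1}}$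 for all $u,v\in M$. It *extends to the next order* if there is $T_{n+1}\in C^1(M,A)$ such that $T_t+t^{n+1}T_{n+1}$ is an order $n+1$ deformation of $T$. A *formal deformation* of $T$ is $T_t=T+\sum_{i\ge1}t^iT_i$ with $T_i\in C^1(M,A)$ such that the induced $\mathbb K[[t]]$-linear map $T_t:M[[t]]\to A[[t]]$ is an $\mathcal O$-operator, where $\mu,\alpha,l,r,\phi$ are extended $\mathbb K[[t]]$-linearly to $A[[t]]$ and $M[[t]]$; its *infinitesimal* is $T_1$. Suppose $H^2(M,A)=0$. Then: 1. for every $n\ge 0$, every order $n$ deformation of $T$ extends to the next order; 2. every $1$-cocycle in $Z^1(M,A)$ is the infinitesimal of some formal deformation of $T$. -/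

import Mathlib

namespace HomDeform

/-! ### Hom-associative algebras, bimodules, O-operators -/

section Algebra

/-- A (multiplicative) Hom-associative algebra structure on the `R`-module `A`. -/
structure HomAssocAlgebra (R A : Type*) [CommRing R] [AddCommGroup A] [Module R A] where
  /-- the product `a · b` -/
  mul : A →ₗ[R] A →ₗ[R] A
  /-- the structure map -/
  α : A →ₗ[R] A
  hom_assoc : ∀ a b c : A, mul (α a) (mul b c) = mul (mul a b) (α c)
  multiplicative : ∀ a b : A, α (mul a b) = mul (α a) (α b)

/-- A bimodule `(M, l, r, φ)` over a Hom-associative algebra. -/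
structure HomBimodule {R A : Type*} [CommRing R] [AddCommGroup A] [Module R A]
    (𝒜 : HomAssocAlgebra R A) (M : Type*) [AddCommGroup M] [Module R M] where
  /-- the left action `l(x, v)` -/
  l : A →ₗ[R] M →ₗ[R] M
  /-- the right action `r(v, x)` -/
  r : M →ₗ[R] A →ₗ[R] M
  /-- the structure map of the bimodule -/
  φ : M →ₗ[R] M
  φ_l : ∀ (x : A) (v : M), φ (l x v) = l (𝒜.α x) (φ v)
  φ_r : ∀ (v : M) (x : A), φ (r v x) = r (φ v) (𝒜.α x)
  l_mul : ∀ (x y : A) (v : M), l (𝒜.mul x y) (φ v) = l (𝒜.α x) (l y v)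
  r_mul : ∀ (v : M) (x y : A), r (φ v) (𝒜.mul x y) = r (r v x) (𝒜.α y)
  l_r : ∀ (x : A) (v : M) (y : A), l (𝒜.α x) (r v y) = r (l x v) (𝒜.α y)

/-- `T : M → A` is an O-operator on `𝒜` with respect to the bimodule `ℳ`. -/
structure IsOOperator {R A M : Type*} [CommRing R] [AddCommGroup A] [Module R A]
    [AddCommGroup M] [Module R M] {𝒜 : HomAssocAlgebra R A} (ℳ : HomBimodule 𝒜 M)
    (T : M →ₗ[R] A) : Prop where
  comm : ∀ u : M, T (ℳ.φ u) = 𝒜.α (T u)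
  mul_eq : ∀ u v : M, 𝒜.mul (T u) (T v) = T (ℳ.l (T u) v + ℳ.r u (T v))

end Algebra

/-! ### The cohomology of an O-operator -/

section Cohomology

variable {R A M : Type*} [CommRing R] [AddCommGroup A] [Module R A]
  [AddCommGroup M] [Module R M] {𝒜 : HomAssocAlgebra R A}

/-- The module of `n`-cochains: `n`-linear maps `f` from `M` to `A` satisfying
`α (f (u₁, …, uₙ)) = f (φ u₁, …, φ uₙ)`. -/
def cochains (ℳ : HomBimodule 𝒜 M) (n : ℕ) :
    Submodule R (MultilinearMap R (fun _ : Fin n => M) A) where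
  carrier := {f | ∀ u : Fin n → M, 𝒜.α (f u) = f (fun i => ℳ.φ (u i))}
  zero_mem' := fun u => by simp
  add_mem' := fun {f g} hf hg u => by
    simp only [_root_.add_apply, map_add]
    rw [hf u, hg u]
  smul_mem' := fun c f hf u => by
    simp only [_root_.smul_apply, map_smul]
    rw [hf u]

/-- The type `Cⁿ(M, A)` of `n`-cochains. -/
def Cochain (ℳ : HomBimodule 𝒜 M) (n : ℕ) : Type _ := ↥(cochains ℳ n)

instance (ℳ : HomBimodule 𝒜 M) (n : ℕ) : AddCommGroup (Cochain ℳ n) :=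
  inferInstanceAs (AddCommGroup ↥(cochains ℳ n))

instance (ℳ : HomBimodule 𝒜 M) (n : ℕ) : Module R (Cochain ℳ n) :=
  inferInstanceAs (Module R ↥(cochains ℳ n))

/-- A linear map `f : M → A`, seen as a map of one variable in the multilinear sense. -/
def toOne (f : M →ₗ[R] A) : MultilinearMap R (fun _ : Fin 1 => M) A :=
  MultilinearMap.ofSubsingleton R M A (0 : Fin 1) f

/-- The product `u ⋆_T v = r(u, T v) + l(T u, v)` on `M`. -/
def starT (ℳ : HomBimodule 𝒜 M) (T : M →ₗ[R] A) : M →ₗ[R] M →ₗ[R] M :=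
  ℳ.r.compl₂ T + ℳ.l ∘ₗ T

@[simp] theorem starT_apply (ℳ : HomBimodule 𝒜 M) (T : M →ₗ[R] A) (u v : M) :
    starT ℳ T u v = ℳ.r u (T v) + ℳ.l (T u) v := rfl

/-- The left action of `(M, ⋆_T)` on `A`: `l_T(u, x) = T u · x - T (r(u, x))`. -/
def lT (ℳ : HomBimodule 𝒜 M) (T : M →ₗ[R] A) : M →ₗ[R] A →ₗ[R] A :=
  𝒜.mul ∘ₗ T - ℳ.r.compr₂ T

@[simp] theorem lT_apply (ℳ : HomBimodule 𝒜 M) (T : M →ₗ[R] A) (u : M) (x : A) :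
    lT ℳ T u x = 𝒜.mul (T u) x - T (ℳ.r u x) := rfl

/-- The right action of `(M, ⋆_T)` on `A`: `r_T(x, u) = x · T u - T (l(x, u))`. -/
def rT (ℳ : HomBimodule 𝒜 M) (T : M →ₗ[R] A) : A →ₗ[R] M →ₗ[R] A :=
  𝒜.mul.compl₂ T - ℳ.l.compr₂ T

@[simp] theorem rT_apply (ℳ : HomBimodule 𝒜 M) (T : M →ₗ[R] A) (x : A) (u : M) :
    rT ℳ T x u = 𝒜.mul x (T u) - T (ℳ.l x u) := rfl

/-- From `(u₀, …, uₙ)` make the `n`-tuple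
`(φ u₀, …, φ u_{i-1}, u_i ⋆_T u_{i+1}, φ u_{i+2}, …, φ uₙ)`. -/
def merge (ℳ : HomBimodule 𝒜 M) (T : M →ₗ[R] A) {n : ℕ} (i : Fin n) (u : Fin (n + 1) → M) :
    Fin n → M := fun j =>
  if j < i then ℳ.φ (u j.castSucc)
  else if j = i then starT ℳ T (u i.castSucc) (u i.succ)
  else ℳ.φ (u j.succ)

theorem exists_merge_update (ℳ : HomBimodule 𝒜 M) (T : M →ₗ[R] A) {n : ℕ} (i : Fin n)
    (u : Fin (n + 1) → M) (k : Fin (n + 1)) :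
    ∃ (j : Fin n) (g : M →ₗ[R] M), ∀ x : M,
      merge ℳ T i (Function.update u k x) = Function.update (merge ℳ T i u) j (g x) := by
  rcases lt_trichotomy (k : ℕ) (i : ℕ) with h | h | h
  · refine ⟨⟨k, by omega⟩, ℳ.φ, fun x => funext fun j => ?_⟩
    simp only [merge, Function.update_apply, Fin.ext_iff, Fin.lt_def, Fin.val_castSucc,
      Fin.val_succ]
    grind
  · refine ⟨i, (starT ℳ T).flip (u i.succ), fun x => funext fun j => ?_⟩
    simp only [merge, Function.update_apply, Fin.ext_iff, Fin.lt_def, Fin.val_castSucc,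
      Fin.val_succ, LinearMap.flip_apply]
    grind
  · rcases Nat.lt_or_ge (i + 1) k with h' | h'
    · refine ⟨⟨(k : ℕ) - 1, by omega⟩, ℳ.φ, fun x => funext fun j => ?_⟩
      simp only [merge, Function.update_apply, Fin.ext_iff, Fin.lt_def, Fin.val_castSucc,
        Fin.val_succ]
      grind
    · refine ⟨i, starT ℳ T (u i.castSucc), fun x => funext fun j => ?_⟩
      simp only [merge, Function.update_apply, Fin.ext_iff, Fin.lt_def, Fin.val_castSucc,
        Fin.val_succ]
      grind

theorem merge_map (ℳ : HomBimodule 𝒜 M) {T : M →ₗ[R] A} (hT : IsOOperator ℳ T) {n : ℕ}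
    (i : Fin n) (u : Fin (n + 1) → M) :
    merge ℳ T i (fun k => ℳ.φ (u k)) = fun j => ℳ.φ (merge ℳ T i u j) := by
  funext j
  simp only [merge]
  split_ifs
  · rfl
  · simp [hT.comm, ℳ.φ_l, ℳ.φ_r]
  · rfl

/-- `(u₁, …, u_{n+2}) ↦ l_T(φⁿ u₁, f(u₂, …, u_{n+2}))`. -/
def leftTerm (ℳ : HomBimodule 𝒜 M) (T : M →ₗ[R] A) {n : ℕ}
    (f : MultilinearMap R (fun _ : Fin (n + 1) => M) A) :
    MultilinearMap R (fun _ : Fin (n + 2) => M) A :=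
  MultilinearMap.mk' (fun u => lT ℳ T ((ℳ.φ ^ n) (u 0)) (f (Fin.tail u)))
    (fun u k x y => by
      refine Fin.cases ?_ (fun k => ?_) k
      · simp only [Fin.tail_update_zero, Function.update_self, map_add, LinearMap.add_apply]
      · simp only [Fin.tail_update_succ, Function.update_of_ne (Fin.succ_ne_zero k).symm,
          f.map_update_add, map_add])
    (fun u k c x => by
      refine Fin.cases ?_ (fun k => ?_) k
      · simp only [Fin.tail_update_zero, Function.update_self, map_smul, LinearMap.smul_apply]
      · simp only [Fin.tail_update_succ, Function.update_of_ne (Fin.succ_ne_zero k).symm,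
          f.map_update_smul, map_smul])

/-- `(u₁, …, u_{n+2}) ↦ f(φ u₁, …, φ u_{i-1}, u_i ⋆_T u_{i+1}, φ u_{i+2}, …, φ u_{n+2})`. -/
def mergeTerm (ℳ : HomBimodule 𝒜 M) (T : M →ₗ[R] A) {n : ℕ} (i : Fin (n + 1))
    (f : MultilinearMap R (fun _ : Fin (n + 1) => M) A) :
    MultilinearMap R (fun _ : Fin (n + 2) => M) A :=
  MultilinearMap.mk' (fun u => f (merge ℳ T i u))
    (fun u k x y => by
      obtain ⟨j, g, h⟩ := exists_merge_update ℳ T i u k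
      simp only [h, map_add, f.map_update_add])
    (fun u k c x => by
      obtain ⟨j, g, h⟩ := exists_merge_update ℳ T i u k
      simp only [h, map_smul, f.map_update_smul])

/-- `(u₁, …, u_{n+2}) ↦ r_T(f(u₁, …, u_{n+1}), φⁿ u_{n+2})`. -/
def rightTerm (ℳ : HomBimodule 𝒜 M) (T : M →ₗ[R] A) {n : ℕ}
    (f : MultilinearMap R (fun _ : Fin (n + 1) => M) A) :
    MultilinearMap R (fun _ : Fin (n + 2) => M) A :=
  MultilinearMap.mk'
    (fun u => rT ℳ T (f (Fin.init u)) ((ℳ.φ ^ n) (u (Fin.last (n + 1)))))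
    (fun u k x y => by
      refine Fin.lastCases ?_ (fun k => ?_) k
      · simp only [Fin.init_update_last, Function.update_self, map_add]
      · simp only [Fin.init_update_castSucc, Function.update_of_ne (Fin.castSucc_ne_last k).symm,
          f.map_update_add, map_add, LinearMap.add_apply])
    (fun u k c x => by
      refine Fin.lastCases ?_ (fun k => ?_) k
      · simp only [Fin.init_update_last, Function.update_self, map_smul]
      · simp only [Fin.init_update_castSucc, Function.update_of_ne (Fin.castSucc_ne_last k).symm,
          f.map_update_smul, map_smul, LinearMap.smul_apply])

/-- The differential `d_H f` of a multilinear map in `n + 1` variables. The index `i : Fin (n + 1)`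
starts at `0`, so that it stands for the position `i + 1` counted from `1`. -/
def dH (ℳ : HomBimodule 𝒜 M) (T : M →ₗ[R] A) {n : ℕ}
    (f : MultilinearMap R (fun _ : Fin (n + 1) => M) A) :
    MultilinearMap R (fun _ : Fin (n + 2) => M) A :=
  leftTerm ℳ T f
    + ∑ i : Fin (n + 1), (-1 : R) ^ ((i : ℕ) + 1) • mergeTerm ℳ T i f
    + (-1 : R) ^ (n + 2) • rightTerm ℳ T f

theorem dH_apply (ℳ : HomBimodule 𝒜 M) (T : M →ₗ[R] A) {n : ℕ}
    (f : MultilinearMap R (fun _ : Fin (n + 1) => M) A) (u : Fin (n + 2) → M) :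
    dH ℳ T f u =
      lT ℳ T ((ℳ.φ ^ n) (u 0)) (f (Fin.tail u))
        + ∑ i : Fin (n + 1), (-1 : R) ^ ((i : ℕ) + 1) • f (merge ℳ T i u)
        + (-1 : R) ^ (n + 2) • rT ℳ T (f (Fin.init u)) ((ℳ.φ ^ n) (u (Fin.last (n + 1)))) := by
  simp [dH, leftTerm, mergeTerm, rightTerm]

theorem pow_φ_comm (ℳ : HomBimodule 𝒜 M) (n : ℕ) (u : M) :
    (ℳ.φ ^ n) (ℳ.φ u) = ℳ.φ ((ℳ.φ ^ n) u) := by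
  rw [← Module.End.mul_apply, ← pow_succ, pow_succ', Module.End.mul_apply]

theorem dH_mem (ℳ : HomBimodule 𝒜 M) {T : M →ₗ[R] A} (hT : IsOOperator ℳ T) {n : ℕ}
    {f : MultilinearMap R (fun _ : Fin (n + 1) => M) A} (hf : f ∈ cochains ℳ (n + 1)) :
    dH ℳ T f ∈ cochains ℳ (n + 2) := by
  intro u
  have hf' : ∀ v : Fin (n + 1) → M, f (fun i => ℳ.φ (v i)) = 𝒜.α (f v) := fun v => (hf v).symm
  have h1 : Fin.tail (fun i => ℳ.φ (u i)) = fun i => ℳ.φ (Fin.tail u i) := rfl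
  have h2 : Fin.init (fun i => ℳ.φ (u i)) = fun i => ℳ.φ (Fin.init u i) := rfl
  simp only [dH_apply, merge_map ℳ hT, h1, h2, hf', map_add, map_sum, map_smul, lT_apply,
    rT_apply, map_sub, 𝒜.multiplicative, pow_φ_comm, hT.comm, ← ℳ.φ_l, ← ℳ.φ_r]

/-- The differential `d_H : Cⁿ⁺¹(M, A) → Cⁿ⁺²(M, A)` of the O-operator `T`. -/
def d (ℳ : HomBimodule 𝒜 M) {T : M →ₗ[R] A} (hT : IsOOperator ℳ T) (n : ℕ) :
    Cochain ℳ (n + 1) →ₗ[R] Cochain ℳ (n + 2) where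
  toFun f := ⟨dH ℳ T f.1, dH_mem ℳ hT f.2⟩
  map_add' f g := by
    refine Subtype.ext (MultilinearMap.ext fun u => ?_)
    change dH ℳ T (f.1 + g.1) u = dH ℳ T f.1 u + dH ℳ T g.1 u
    simp only [dH_apply, _root_.add_apply, map_add, smul_add,
      Finset.sum_add_distrib, LinearMap.add_apply]
    abel
  map_smul' c f := by
    refine Subtype.ext (MultilinearMap.ext fun u => ?_)
    change dH ℳ T (c • f.1) u = c • dH ℳ T f.1 u
    simp only [dH_apply, _root_.smul_apply, map_smul, smul_add,
      Finset.smul_sum, LinearMap.smul_apply, smul_comm c]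

/-- The cocycles `Zⁿ⁺¹(M, A)` of degree `n + 1`. -/
def cocycles (ℳ : HomBimodule 𝒜 M) {T : M →ₗ[R] A} (hT : IsOOperator ℳ T) (n : ℕ) :
    Submodule R (Cochain ℳ (n + 1)) :=
  LinearMap.ker (d ℳ hT n)

/-- The coboundaries `Bⁿ⁺²(M, A)` of degree `n + 2`. -/
def coboundaries (ℳ : HomBimodule 𝒜 M) {T : M →ₗ[R] A} (hT : IsOOperator ℳ T) (n : ℕ) :
    Submodule R (Cochain ℳ (n + 2)) :=
  LinearMap.range (d ℳ hT n)

/-- The cohomology `Hⁿ⁺²(M, A) = Zⁿ⁺²(M, A) / Bⁿ⁺²(M, A)` of the O-operator `T`. -/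
abbrev cohomology (ℳ : HomBimodule 𝒜 M) {T : M →ₗ[R] A} (hT : IsOOperator ℳ T) (n : ℕ) : Type _ :=
  cocycles ℳ hT (n + 1) ⧸ (coboundaries ℳ hT n).submoduleOf (cocycles ℳ hT (n + 1))

/-- The group `Z¹(M, A)` of `1`-cocycles. -/
abbrev Z1 (ℳ : HomBimodule 𝒜 M) {T : M →ₗ[R] A} (hT : IsOOperator ℳ T) :
    Submodule R (Cochain ℳ 1) :=
  cocycles ℳ hT 0

/-- The second cohomology `H²(M, A)`. -/
abbrev H2 (ℳ : HomBimodule 𝒜 M) {T : M →ₗ[R] A} (hT : IsOOperator ℳ T) : Type _ :=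
  cohomology ℳ hT 0

end Cohomology

/-! ### Extension of scalars to formal power series -/

section Series

/-- `M[[t]]`: formal power series in `t` with coefficients in `M`; the series `Σ tⁱ mᵢ` is the
sequence `m` of its coefficients. -/
def FormalSeries (M : Type*) : Type _ := ℕ → M

namespace FormalSeries

/-- The coefficient of `tᵏ`. -/
def coeff {M : Type*} (k : ℕ) (u : FormalSeries M) : M := u k

/-- The series with given coefficients. -/
def mk {M : Type*} (u : ℕ → M) : FormalSeries M := u

@[simp] theorem coeff_mk {M : Type*} (k : ℕ) (u : ℕ → M) : coeff k (mk u) = u k := rfl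

@[ext] theorem ext {M : Type*} {u v : FormalSeries M} (h : ∀ k, coeff k u = coeff k v) : u = v :=
  funext h

variable {R M N P Q S V : Type*} [CommRing R] [AddCommGroup M] [Module R M]
  [AddCommGroup N] [Module R N] [AddCommGroup P] [Module R P] [AddCommGroup Q] [Module R Q]
  [AddCommGroup S] [Module R S] [AddCommGroup V] [Module R V]

instance : AddCommGroup (FormalSeries M) := inferInstanceAs (AddCommGroup (ℕ → M))

@[simp] theorem coeff_zero (k : ℕ) : coeff k (0 : FormalSeries M) = 0 := rfl

@[simp] theorem coeff_add (k : ℕ) (u v : FormalSeries M) :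
    coeff k (u + v) = coeff k u + coeff k v := rfl

/-- `Σ_{i + j = k} b(uᵢ, vⱼ)`, the coefficient of `tᵏ` in the product of two series. -/
def conv (b : M →ₗ[R] N →ₗ[R] P) (u : ℕ → M) (v : ℕ → N) (k : ℕ) : P :=
  ∑ p ∈ Finset.HasAntidiagonal.antidiagonal k, b (u p.1) (v p.2)

theorem conv_assoc (b₁ : M →ₗ[R] N →ₗ[R] P) (b₂ : P →ₗ[R] Q →ₗ[R] S)
    (c₁ : N →ₗ[R] Q →ₗ[R] V) (c₂ : M →ₗ[R] V →ₗ[R] S)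
    (u u' : ℕ → M) (v : ℕ → N) (w w' : ℕ → Q)
    (h : ∀ i j k, b₂ (b₁ (u i) (v j)) (w k) = c₂ (u' i) (c₁ (v j) (w' k))) :
    conv b₂ (conv b₁ u v) w = conv c₂ u' (conv c₁ v w') := by
  funext k
  simp only [conv, map_sum, LinearMap.sum_apply, Finset.sum_sigma']
  refine Finset.sum_nbij' (fun x => ⟨(x.2.1, x.2.2 + x.1.2), (x.2.2, x.1.2)⟩)
    (fun x => ⟨(x.1.1 + x.2.1, x.2.2), (x.1.1, x.2.1)⟩) ?_ ?_ ?_ ?_ ?_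
  · rintro ⟨⟨a, b⟩, ⟨c, e⟩⟩ hx
    simp only [Finset.mem_sigma, Finset.HasAntidiagonal.mem_antidiagonal] at hx ⊢
    grind
  · rintro ⟨⟨a, b⟩, ⟨c, e⟩⟩ hx
    simp only [Finset.mem_sigma, Finset.HasAntidiagonal.mem_antidiagonal] at hx ⊢
    grind
  · rintro ⟨⟨a, b⟩, ⟨c, e⟩⟩ hx
    simp only [Finset.mem_sigma, Finset.HasAntidiagonal.mem_antidiagonal] at hx
    obtain ⟨-, rfl⟩ := hx
    rfl
  · rintro ⟨⟨a, b⟩, ⟨c, e⟩⟩ hx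
    simp only [Finset.mem_sigma, Finset.HasAntidiagonal.mem_antidiagonal] at hx
    obtain ⟨-, rfl⟩ := hx
    rfl
  · rintro ⟨⟨a, b⟩, ⟨c, e⟩⟩ hx
    exact h _ _ _

/-- `M[[t]]` is a module over `R[[t]]`: `(p u)ₖ = Σ_{i + j = k} pᵢ uⱼ`. -/
noncomputable instance : SMul (PowerSeries R) (FormalSeries M) where
  smul p u := mk (conv (LinearMap.lsmul R M) (fun i => PowerSeries.coeff i p)
    (fun j => coeff j u))

theorem coeff_smul (k : ℕ) (p : PowerSeries R) (u : FormalSeries M) :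
    coeff k (p • u) =
      ∑ x ∈ Finset.HasAntidiagonal.antidiagonal k, PowerSeries.coeff x.1 p • coeff x.2 u := rfl

noncomputable instance : Module (PowerSeries R) (FormalSeries M) where
  one_smul u := by
    ext k
    rw [coeff_smul, Finset.sum_eq_single (0, k)]
    · simp
    · rintro ⟨a, b⟩ hx hne
      have ha : a ≠ 0 := by
        rintro rfl
        simp_all
      simp [PowerSeries.coeff_one, ha]
    · simp
  mul_smul p q u := by
    have := conv_assoc (LinearMap.mul R R) (LinearMap.lsmul R M) (LinearMap.lsmul R M)
      (LinearMap.lsmul R M) (fun i => PowerSeries.coeff i p) (fun i => PowerSeries.coeff i p)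
      (fun i => PowerSeries.coeff i q) (fun i => coeff i u) (fun i => coeff i u)
      (fun i j k => mul_smul (PowerSeries.coeff i p) (PowerSeries.coeff j q) (coeff k u))
    ext k
    refine Eq.trans ?_ (congrFun this k)
    simp only [coeff_smul, conv, PowerSeries.coeff_mul, LinearMap.mul_apply', LinearMap.lsmul_apply]
  smul_zero p := by
    ext k
    simp [coeff_smul]
  smul_add p u v := by
    ext k
    simp [coeff_smul, Finset.sum_add_distrib]
  add_smul p q u := by
    ext k
    simp [coeff_smul, add_smul, Finset.sum_add_distrib]
  zero_smul u := by
    ext k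
    simp [coeff_smul]

/-- The constant series `m`. -/
def const (m : M) : FormalSeries M := mk (Pi.single 0 m)

/-- The `R[[t]]`-bilinear extension of a bilinear map:
`b_t(u, v)ₖ = Σ_{i + j = k} b(uᵢ, vⱼ)`. -/
noncomputable def bilinear (b : M →ₗ[R] N →ₗ[R] P) :
    FormalSeries M →ₗ[PowerSeries R] FormalSeries N →ₗ[PowerSeries R] FormalSeries P :=
  LinearMap.mk₂ (PowerSeries R)
    (fun u v => mk (conv b (fun i => coeff i u) (fun j => coeff j v)))
    (fun u u' v => by
      ext k
      simp [conv, Finset.sum_add_distrib])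
    (fun p u v => by
      ext k
      exact congrFun (conv_assoc (LinearMap.lsmul R M) b b (LinearMap.lsmul R P)
        (fun i => PowerSeries.coeff i p) (fun i => PowerSeries.coeff i p) (fun i => coeff i u)
        (fun i => coeff i v) (fun i => coeff i v) (fun i j k => by simp)) k)
    (fun u v v' => by
      ext k
      simp [conv, Finset.sum_add_distrib])
    (fun p u v => by
      ext k
      have h1 := congrFun (conv_assoc (LinearMap.lsmul R M).flip b (LinearMap.lsmul R N)
        b (fun i => coeff i u) (fun i => coeff i u) (fun i => PowerSeries.coeff i p)
        (fun i => coeff i v) (fun i => coeff i v) (fun i j k => by simp)) k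
      have h2 := congrFun (conv_assoc (LinearMap.lsmul R M) b b (LinearMap.lsmul R P)
        (fun i => PowerSeries.coeff i p) (fun i => PowerSeries.coeff i p) (fun i => coeff i u)
        (fun i => coeff i v) (fun i => coeff i v) (fun i j k => by simp)) k
      refine Eq.trans h1.symm (Eq.trans ?_ h2)
      have : conv (LinearMap.lsmul R M).flip (fun i => coeff i u)
          (fun i => PowerSeries.coeff i p) = conv (LinearMap.lsmul R M)
          (fun i => PowerSeries.coeff i p) (fun i => coeff i u) := by
        funext n
        simp only [conv]
        rw [← Finset.Nat.sum_antidiagonal_swap]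
        rfl
      rw [this])

@[simp] theorem coeff_bilinear (b : M →ₗ[R] N →ₗ[R] P) (u : FormalSeries M) (v : FormalSeries N)
    (k : ℕ) : coeff k (bilinear b u v) =
      ∑ x ∈ Finset.HasAntidiagonal.antidiagonal k, b (coeff x.1 u) (coeff x.2 v) := rfl

/-- The `R[[t]]`-linear extension of a linear map, applied coefficientwise. -/
noncomputable def map (f : M →ₗ[R] N) : FormalSeries M →ₗ[PowerSeries R] FormalSeries N where
  toFun u := mk fun i => f (coeff i u)
  map_add' u v := by
    ext k
    simp
  map_smul' p u := by
    ext k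
    simp [coeff_smul]

@[simp] theorem coeff_map (f : M →ₗ[R] N) (u : FormalSeries M) (k : ℕ) :
    coeff k (map f u) = f (coeff k u) := rfl

/-- The `R[[t]]`-linear map `Σ tⁱ fᵢ : M[[t]] → N[[t]]` given by a sequence of linear maps
`fᵢ : M → N`: its value at `u` has the coefficients `Σ_{i + j = k} fᵢ(uⱼ)`. -/
noncomputable def sumMap (f : ℕ → M →ₗ[R] N) : FormalSeries M →ₗ[PowerSeries R] FormalSeries N :=
  bilinear (LinearMap.id : (M →ₗ[R] N) →ₗ[R] M →ₗ[R] N) (mk f)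

@[simp] theorem coeff_sumMap (f : ℕ → M →ₗ[R] N) (u : FormalSeries M) (k : ℕ) :
    coeff k (sumMap f u) = ∑ x ∈ Finset.HasAntidiagonal.antidiagonal k, f x.1 (coeff x.2 u) := rfl

end FormalSeries

open FormalSeries in
/-- The Hom-associative algebra `(A[[t]], μ_t, α_t)` over `R[[t]]`. -/
noncomputable def HomAssocAlgebra.series {R A : Type*} [CommRing R] [AddCommGroup A] [Module R A]
    (𝒜 : HomAssocAlgebra R A) : HomAssocAlgebra (PowerSeries R) (FormalSeries A) where
  mul := bilinear 𝒜.mul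
  α := FormalSeries.map 𝒜.α
  hom_assoc a b c := by
    ext k
    exact congrFun (conv_assoc 𝒜.mul 𝒜.mul 𝒜.mul 𝒜.mul (fun i => coeff i a)
      (fun i => 𝒜.α (coeff i a)) (fun i => coeff i b) (fun i => 𝒜.α (coeff i c))
      (fun i => coeff i c) (fun i j k => (𝒜.hom_assoc _ _ _).symm)).symm k
  multiplicative a b := by
    ext k
    simp [𝒜.multiplicative]

open FormalSeries in
/-- The bimodule `(M[[t]], l_t, r_t, φ_t)` over `(A[[t]], μ_t, α_t)`. -/
noncomputable def HomBimodule.series {R A M : Type*} [CommRing R] [AddCommGroup A] [Module R A]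
    [AddCommGroup M] [Module R M] {𝒜 : HomAssocAlgebra R A} (ℳ : HomBimodule 𝒜 M) :
    HomBimodule 𝒜.series (FormalSeries M) where
  l := bilinear ℳ.l
  r := bilinear ℳ.r
  φ := FormalSeries.map ℳ.φ
  φ_l x v := by
    ext k
    simp [HomAssocAlgebra.series, ℳ.φ_l]
  φ_r v x := by
    ext k
    simp [HomAssocAlgebra.series, ℳ.φ_r]
  l_mul x y v := by
    ext k
    exact congrFun (conv_assoc 𝒜.mul ℳ.l ℳ.l ℳ.l (fun i => coeff i x)
      (fun i => 𝒜.α (coeff i x)) (fun i => coeff i y) (fun i => ℳ.φ (coeff i v))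
      (fun i => coeff i v) (fun i j k => ℳ.l_mul _ _ _)) k
  r_mul v x y := by
    ext k
    exact congrFun (conv_assoc ℳ.r ℳ.r 𝒜.mul ℳ.r (fun i => coeff i v)
      (fun i => ℳ.φ (coeff i v)) (fun i => coeff i x) (fun i => 𝒜.α (coeff i y))
      (fun i => coeff i y) (fun i j k => (ℳ.r_mul _ _ _).symm)).symm k
  l_r x v y := by
    ext k
    exact congrFun (conv_assoc ℳ.l ℳ.r ℳ.r ℳ.l (fun i => coeff i x)
      (fun i => 𝒜.α (coeff i x)) (fun i => coeff i v) (fun i => 𝒜.α (coeff i y))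
      (fun i => coeff i y) (fun i j k => (ℳ.l_r _ _ _).symm)).symm k

end Series

/-! ### Deformations of an O-operator -/

section Deformation

variable {R A M : Type*} [CommRing R] [AddCommGroup A] [Module R A]
  [AddCommGroup M] [Module R M] {𝒜 : HomAssocAlgebra R A}

/-- `T_t = Σ_{i ≥ 0} tⁱ Tᵢ` is a formal deformation of `T`: `T₀ = T`, every `Tᵢ` is a `1`-cochain,
and `T_t : M[[t]] → A[[t]]` is an O-operator over `R[[t]]`. -/
structure IsFormalDeformation (ℳ : HomBimodule 𝒜 M) (T : M →ₗ[R] A) (Tt : ℕ → M →ₗ[R] A) :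
    Prop where
  zero_eq : Tt 0 = T
  mem_cochains : ∀ i, toOne (Tt i) ∈ cochains ℳ 1
  isOOperator : IsOOperator ℳ.series (FormalSeries.sumMap Tt)

/-- `T_t = T + Σ_{1 ≤ i ≤ n} tⁱ Tᵢ` is an order `n` deformation of `T`: every `Tᵢ` is a
`1`-cochain, and `T_t(u) · T_t(v) = T_t(T_t(u) v + u T_t(v))` modulo `tⁿ⁺¹` for all `u, v` in `M`.
The sequence `Tt` of coefficients vanishes above `n`. -/
structure IsOrderDeformation (ℳ : HomBimodule 𝒜 M) (T : M →ₗ[R] A) (n : ℕ)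
    (Tt : ℕ → M →ₗ[R] A) : Prop where
  zero_eq : Tt 0 = T
  eq_zero : ∀ i, n < i → Tt i = 0
  mem_cochains : ∀ i, toOne (Tt i) ∈ cochains ℳ 1
  mul_eq : ∀ u v : M, ∀ k ≤ n,
    FormalSeries.coeff k (𝒜.series.mul (FormalSeries.sumMap Tt (FormalSeries.const u))
      (FormalSeries.sumMap Tt (FormalSeries.const v))) =
    FormalSeries.coeff k (FormalSeries.sumMap Tt
      (ℳ.series.l (FormalSeries.sumMap Tt (FormalSeries.const u)) (FormalSeries.const v) +
        ℳ.series.r (FormalSeries.const u) (FormalSeries.sumMap Tt (FormalSeries.const v))))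

/-- The order `n` deformation `T_t` extends to a deformation of order `n + 1`: there is a
`1`-cochain `S` such that `T_t + tⁿ⁺¹ S` is a deformation of order `n + 1`. -/
def IsExtendable (ℳ : HomBimodule 𝒜 M) (T : M →ₗ[R] A) (n : ℕ) (Tt : ℕ → M →ₗ[R] A) : Prop :=
  ∃ S : M →ₗ[R] A, toOne S ∈ cochains ℳ 1 ∧
    IsOrderDeformation ℳ T (n + 1) (Tt + Pi.single (n + 1) S)

end Deformation

end HomDeform

/-! For a linear map `T` commuting with the structure maps, let E(T)(u, v) = T u · T v - T(u ⋆_T v)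
be its defect, so that O-operators are the zeros of E. The Hom-associativity and bimodule axioms
alone give a Bianchi identity (`bianchi`): the formula for d_H built from `T` annihilates E(T), even
if `T` is not an O-operator.

The identity is applied over R[[t]] to T_t = Σ tⁱ Tᵢ. If E(T_t) vanishes modulo tⁿ⁺¹, the
coefficient of tⁿ⁺¹ in the identity sees the actions only through T₀, so the leading coefficient
E_{n+1} is a 2-cocycle for T₀ (`curvature_closed`). Adding tⁿ⁺¹ S to an order n deformation changes
E_{n+1} by d_H S (`curvature_add_single`). When H² = 0, some S satisfies d_H S = -E_{n+1}, which is
the extension to the next order.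

A 1-cocycle S makes T + tS an order 1 deformation. Iterated extension never alters earlier
coefficients, so the limit series exists and all its E_k vanish. -/

namespace HomDeform

/-! ### The defect, its Bianchi identity and its power series coefficients -/

section Curvature

variable {R A M : Type*} [CommRing R] [AddCommGroup A] [Module R A]
  [AddCommGroup M] [Module R M] {𝒜 : HomAssocAlgebra R A}

/-- The defect `(u, v) ↦ T u · T v - T (u ⋆_S v)`. For `S = T` it measures the failure of `T` to be
an O-operator. -/
def defect (ℳ : HomBimodule 𝒜 M) (T S : M →ₗ[R] A) : M →ₗ[R] M →ₗ[R] A :=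
  𝒜.mul.compl₁₂ T S - (starT ℳ S).compr₂ T

theorem defect_apply (ℳ : HomBimodule 𝒜 M) (T S : M →ₗ[R] A) (u v : M) :
    defect ℳ T S u v = 𝒜.mul (T u) (S v) - T (ℳ.r u (S v) + ℳ.l (S u) v) := rfl

/-- The defect of a linear map that commutes with the structure maps satisfies a Bianchi
identity. -/
theorem bianchi (ℳ : HomBimodule 𝒜 M) (T : M →ₗ[R] A) (hT : ∀ u, T (ℳ.φ u) = 𝒜.α (T u))
    (u v w : M) :
    𝒜.mul (T (ℳ.φ u)) (defect ℳ T T v w) - T (ℳ.r (ℳ.φ u) (defect ℳ T T v w))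
      - defect ℳ T T (starT ℳ T u v) (ℳ.φ w) + defect ℳ T T (ℳ.φ u) (starT ℳ T v w)
      - 𝒜.mul (defect ℳ T T u v) (T (ℳ.φ w)) + T (ℳ.l (defect ℳ T T u v) (ℳ.φ w)) = 0 := by
  -- `hT` turns T(φ u) into α(T u), the form in which the Hom axioms apply; after normalisation by
  -- them the terms cancel in pairs.
  simp only [defect_apply, starT_apply, hT, map_sub, map_add, LinearMap.sub_apply,
    LinearMap.add_apply, 𝒜.hom_assoc, ℳ.r_mul, ℳ.l_mul, ℳ.l_r]
  abel

/-- The coefficient of `tᵏ` in the defect of `Σ tⁱ Tᵢ`. -/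
def curvature (ℳ : HomBimodule 𝒜 M) (Tt : ℕ → M →ₗ[R] A) (k : ℕ) : M →ₗ[R] M →ₗ[R] A :=
  ∑ x ∈ Finset.HasAntidiagonal.antidiagonal k, defect ℳ (Tt x.1) (Tt x.2)

theorem curvature_apply (ℳ : HomBimodule 𝒜 M) (Tt : ℕ → M →ₗ[R] A) (k : ℕ) (u v : M) :
    curvature ℳ Tt k u v =
      ∑ x ∈ Finset.HasAntidiagonal.antidiagonal k, defect ℳ (Tt x.1) (Tt x.2) u v := by
  simp [curvature, LinearMap.sum_apply]

theorem curvature_congr (ℳ : HomBimodule 𝒜 M) {Tt Tt' : ℕ → M →ₗ[R] A} {k : ℕ}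
    (h : ∀ i ≤ k, Tt i = Tt' i) : curvature ℳ Tt k = curvature ℳ Tt' k := by
  refine Finset.sum_congr rfl fun x hx => ?_
  rw [Finset.HasAntidiagonal.mem_antidiagonal] at hx
  rw [h x.1 (by omega), h x.2 (by omega)]

theorem toOne_mem_cochains (ℳ : HomBimodule 𝒜 M) (f : M →ₗ[R] A) :
    toOne f ∈ cochains ℳ 1 ↔ ∀ u, f (ℳ.φ u) = 𝒜.α (f u) :=
  ⟨fun h u => (h fun _ => u).symm, fun h u => (h (u 0)).symm⟩

theorem curvature_φ (ℳ : HomBimodule 𝒜 M) {Tt : ℕ → M →ₗ[R] A}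
    (h : ∀ i, toOne (Tt i) ∈ cochains ℳ 1) (k : ℕ) (u v : M) :
    curvature ℳ Tt k (ℳ.φ u) (ℳ.φ v) = 𝒜.α (curvature ℳ Tt k u v) := by
  have h' := fun i => (toOne_mem_cochains ℳ (Tt i)).1 (h i)
  simp only [curvature_apply, defect_apply, map_sum, map_sub, map_add, h', 𝒜.multiplicative,
    ← ℳ.φ_l, ← ℳ.φ_r]

end Curvature

/-! ### Bilinear maps over R[[t]] and their leading coefficients -/

namespace FormalSeries

variable {R M N P : Type*} [CommRing R] [AddCommGroup M] [Module R M]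
  [AddCommGroup N] [Module R N] [AddCommGroup P] [Module R P]

@[simp] theorem coeff_sub (k : ℕ) (u v : FormalSeries M) :
    coeff k (u - v) = coeff k u - coeff k v := rfl

@[simp] theorem coeff_zero_const (m : M) : coeff 0 (const m) = m := by simp [const]

theorem coeff_const_of_ne (m : M) {k : ℕ} (hk : k ≠ 0) : coeff k (const m) = 0 := by
  simp [const, hk]

theorem map_const (f : M →ₗ[R] N) (m : M) : map f (const m) = const (f m) := by
  ext k
  rcases eq_or_ne k 0 with rfl | hk
  · simp
  · simp [coeff_const_of_ne _ hk]

theorem coeff_bilinear_of_right (b : M →ₗ[R] N →ₗ[R] P) (u : FormalSeries M)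
    {v : FormalSeries N} {n : ℕ} (hv : ∀ k < n, coeff k v = 0) :
    coeff n (bilinear b u v) = b (coeff 0 u) (coeff n v) := by
  rw [coeff_bilinear, Finset.sum_eq_single (0, n)]
  · rintro ⟨i, j⟩ hx hne
    rw [Finset.HasAntidiagonal.mem_antidiagonal] at hx
    rw [hv j (by grind), map_zero]
  · simp

theorem coeff_bilinear_of_left (b : M →ₗ[R] N →ₗ[R] P) {u : FormalSeries M}
    (v : FormalSeries N) {n : ℕ} (hu : ∀ k < n, coeff k u = 0) :
    coeff n (bilinear b u v) = b (coeff n u) (coeff 0 v) := by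
  rw [coeff_bilinear, Finset.sum_eq_single (n, 0)]
  · rintro ⟨i, j⟩ hx hne
    rw [Finset.HasAntidiagonal.mem_antidiagonal] at hx
    rw [hu i (by grind), map_zero, LinearMap.zero_apply]
  · simp

theorem coeff_bilinear_of_right_lt (b : M →ₗ[R] N →ₗ[R] P) (u : FormalSeries M)
    {v : FormalSeries N} {n : ℕ} (hv : ∀ k < n, coeff k v = 0) {k : ℕ} (hk : k < n) :
    coeff k (bilinear b u v) = 0 := by
  rw [coeff_bilinear_of_right b u fun j hj => hv j (hj.trans hk), hv k hk, map_zero]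

theorem coeff_bilinear_of_left_lt (b : M →ₗ[R] N →ₗ[R] P) {u : FormalSeries M}
    (v : FormalSeries N) {n : ℕ} (hu : ∀ k < n, coeff k u = 0) {k : ℕ} (hk : k < n) :
    coeff k (bilinear b u v) = 0 := by
  rw [coeff_bilinear_of_left b v fun j hj => hu j (hj.trans hk), hu k hk, map_zero,
    LinearMap.zero_apply]

theorem coeff_sumMap_of_lt (f : ℕ → M →ₗ[R] N) {v : FormalSeries M} {n : ℕ}
    (hv : ∀ k < n, coeff k v = 0) : coeff n (sumMap f v) = f 0 (coeff n v) :=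
  coeff_bilinear_of_right LinearMap.id (mk f) hv

theorem coeff_bilinear_const_right (b : M →ₗ[R] N →ₗ[R] P) (u : FormalSeries M) (v : N) (k : ℕ) :
    coeff k (bilinear b u (const v)) = b (coeff k u) v := by
  rw [coeff_bilinear, Finset.sum_eq_single (k, 0)]
  · simp
  · rintro ⟨i, j⟩ hx hne
    rw [Finset.HasAntidiagonal.mem_antidiagonal] at hx
    rw [coeff_const_of_ne _ (by grind), map_zero]
  · simp

theorem coeff_bilinear_const_left (b : M →ₗ[R] N →ₗ[R] P) (u : M) (v : FormalSeries N) (k : ℕ) :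
    coeff k (bilinear b (const u) v) = b u (coeff k v) := by
  rw [coeff_bilinear, Finset.sum_eq_single (0, k)]
  · simp
  · rintro ⟨i, j⟩ hx hne
    rw [Finset.HasAntidiagonal.mem_antidiagonal] at hx
    rw [coeff_const_of_ne _ (by grind), map_zero, LinearMap.zero_apply]
  · simp

theorem coeff_sumMap_const (f : ℕ → M →ₗ[R] N) (u : M) (k : ℕ) :
    coeff k (sumMap f (const u)) = f k u :=
  coeff_bilinear_const_right LinearMap.id (mk f) u k

theorem coeff_X_smul_zero (u : FormalSeries M) :
    coeff 0 ((PowerSeries.X : PowerSeries R) • u) = 0 := by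
  simp [coeff_smul]

theorem coeff_X_smul_succ (u : FormalSeries M) (k : ℕ) :
    coeff (k + 1) ((PowerSeries.X : PowerSeries R) • u) = coeff k u := by
  rw [coeff_smul, Finset.sum_eq_single (1, k)]
  · simp
  · rintro ⟨i, j⟩ hx hne
    rw [Finset.HasAntidiagonal.mem_antidiagonal] at hx
    rw [PowerSeries.coeff_X, if_neg (by grind), zero_smul]
  · simp [add_comm]

/-- `Σ tⁱ uᵢ = u₀ + t Σ tⁱ uᵢ₊₁`. -/
theorem eq_const_add_X_smul (R : Type*) [CommRing R] [Module R M] (u : FormalSeries M) :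
    u = const (coeff 0 u) + (PowerSeries.X : PowerSeries R) • mk fun i => coeff (i + 1) u := by
  ext k
  rcases k with _ | k
  · simp [coeff_X_smul_zero]
  · simp [coeff_X_smul_succ, coeff_const_of_ne]

/-- Writing u = u₀ + t u' and v = v₀ + t v' gives B(u, v) = B(u₀, v₀) + t (B(u', v₀) + B(u, v')).
The remainder is a sum of values of B, so it inherits any vanishing of a coefficient of B; this
drives the induction on coefficients for an arbitrary R[[t]]-bilinear B. -/
theorem coeff_bilin_split
    (B : FormalSeries M →ₗ[PowerSeries R] FormalSeries N →ₗ[PowerSeries R] FormalSeries P)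
    (u : FormalSeries M) (v : FormalSeries N) :
    ∃ w : FormalSeries P, (∀ k : ℕ, (∀ u v, coeff k (B u v) = 0) → coeff k w = 0) ∧
      B u v = B (const (coeff 0 u)) (const (coeff 0 v)) + (PowerSeries.X : PowerSeries R) • w := by
  refine ⟨B (mk fun i => coeff (i + 1) u) (const (coeff 0 v)) +
    B u (mk fun i => coeff (i + 1) v), fun k hk => by simp [hk], ?_⟩
  conv_lhs => rw [eq_const_add_X_smul R v, map_add, eq_const_add_X_smul R u]
  conv_rhs => enter [2, 2, 2]; rw [eq_const_add_X_smul R u]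
  simp only [map_add, map_smul, LinearMap.add_apply, LinearMap.smul_apply, smul_add, add_assoc]

/-- An `R[[t]]`-bilinear map that vanishes modulo `tⁿ` on constants vanishes modulo `tⁿ`. -/
theorem coeff_bilin_eq_zero
    (B : FormalSeries M →ₗ[PowerSeries R] FormalSeries N →ₗ[PowerSeries R] FormalSeries P)
    {n : ℕ} (h : ∀ k < n, ∀ u v, coeff k (B (const u) (const v)) = 0) :
    ∀ k < n, ∀ u v, coeff k (B u v) = 0 := by
  intro k
  induction k with
  | zero =>
    intro hk u v
    obtain ⟨w, -, hB⟩ := coeff_bilin_split B u v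
    rw [hB, coeff_add, h 0 hk, coeff_X_smul_zero, add_zero]
  | succ k ih =>
    intro hk u v
    obtain ⟨w, hw, hB⟩ := coeff_bilin_split B u v
    -- The factor t shifts the index: coefficient k + 1 of t w is coefficient k of w, covered by the
    -- induction hypothesis.
    rw [hB, coeff_add, h _ hk, coeff_X_smul_succ, zero_add, hw k (ih (by omega))]

/-- The leading coefficient of an `R[[t]]`-bilinear map is determined by constant terms. -/
theorem coeff_bilin_eq
    (B : FormalSeries M →ₗ[PowerSeries R] FormalSeries N →ₗ[PowerSeries R] FormalSeries P)
    {n : ℕ} (h : ∀ k < n, ∀ u v, coeff k (B (const u) (const v)) = 0)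
    (u : FormalSeries M) (v : FormalSeries N) :
    coeff n (B u v) = coeff n (B (const (coeff 0 u)) (const (coeff 0 v))) := by
  obtain ⟨w, hw, hB⟩ := coeff_bilin_split B u v
  rw [hB, coeff_add]
  rcases n with _ | n
  · rw [coeff_X_smul_zero, add_zero]
  · rw [coeff_X_smul_succ, hw n (coeff_bilin_eq_zero B h n (by omega)), add_zero]

end FormalSeries

/-! ### The obstruction class and its cocycle property -/

section Obstruction

open FormalSeries

variable {R A M : Type*} [CommRing R] [AddCommGroup A] [Module R A]
  [AddCommGroup M] [Module R M] {𝒜 : HomAssocAlgebra R A}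

/-- The bridge between the two pictures: the defect of T_t over R[[t]], to which `bianchi` applies,
and the coefficients E_k on M. -/
theorem coeff_defect_const (ℳ : HomBimodule 𝒜 M) (Tt : ℕ → M →ₗ[R] A) (u v : M) (k : ℕ) :
    coeff k (defect ℳ.series (sumMap Tt) (sumMap Tt) (const u) (const v)) =
      curvature ℳ Tt k u v := by
  simp only [defect_apply, curvature_apply, Finset.sum_sub_distrib, coeff_sub]
  congr 1
  · simp only [HomAssocAlgebra.series, coeff_bilinear, coeff_sumMap_const]
  · rw [coeff_sumMap]
    simp only [HomBimodule.series, coeff_add, coeff_bilinear_const_left,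
      coeff_bilinear_const_right, coeff_sumMap_const]

theorem sumMap_comm (ℳ : HomBimodule 𝒜 M) {Tt : ℕ → M →ₗ[R] A}
    (h : ∀ i, toOne (Tt i) ∈ cochains ℳ 1) (u : FormalSeries M) :
    sumMap Tt (ℳ.series.φ u) = 𝒜.series.α (sumMap Tt u) := by
  ext k
  simp [HomAssocAlgebra.series, HomBimodule.series, (toOne_mem_cochains ℳ (Tt _)).1 (h _)]

/-- The leading coefficient of the curvature is closed. -/
theorem curvature_closed (ℳ : HomBimodule 𝒜 M) {Tt : ℕ → M →ₗ[R] A}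
    (h : ∀ i, toOne (Tt i) ∈ cochains ℳ 1) {n : ℕ} (hn : ∀ k < n, curvature ℳ Tt k = 0)
    (u v w : M) :
    lT ℳ (Tt 0) (ℳ.φ u) (curvature ℳ Tt n v w)
      - curvature ℳ Tt n (starT ℳ (Tt 0) u v) (ℳ.φ w)
      + curvature ℳ Tt n (ℳ.φ u) (starT ℳ (Tt 0) v w)
      - rT ℳ (Tt 0) (curvature ℳ Tt n u v) (ℳ.φ w) = 0 := by
  have hB : ∀ k < n, ∀ u v,
      coeff k (defect ℳ.series (sumMap Tt) (sumMap Tt) (const u) (const v)) = 0 :=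
    fun k hk u v => by rw [coeff_defect_const, hn k hk]; rfl
  -- The defect vanishes modulo tⁿ on all series, not only on constants. Hence in the coefficient of
  -- tⁿ every other factor contributes only its constant term, which is what `hr`, `hl`, `hr'` and
  -- `hl'` record.
  have hE := coeff_bilin_eq_zero _ hB
  have key := congrArg (coeff n)
    (bianchi ℳ.series (sumMap Tt) (sumMap_comm ℳ h) (const u) (const v) (const w))
  have hr : ∀ a b c, coeff n (𝒜.series.mul a
      (defect ℳ.series (sumMap Tt) (sumMap Tt) b c)) = 𝒜.mul (coeff 0 a)
      (coeff n (defect ℳ.series (sumMap Tt) (sumMap Tt) b c)) := fun a b c =>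
    coeff_bilinear_of_right _ _ fun k hk => hE k hk _ _
  have hl : ∀ a b c, coeff n (𝒜.series.mul
      (defect ℳ.series (sumMap Tt) (sumMap Tt) b c) a) = 𝒜.mul
      (coeff n (defect ℳ.series (sumMap Tt) (sumMap Tt) b c)) (coeff 0 a) := fun a b c =>
    coeff_bilinear_of_left _ _ fun k hk => hE k hk _ _
  have hr' : ∀ a b c, coeff n (sumMap Tt (ℳ.series.r a
      (defect ℳ.series (sumMap Tt) (sumMap Tt) b c))) = Tt 0 (ℳ.r (coeff 0 a)
      (coeff n (defect ℳ.series (sumMap Tt) (sumMap Tt) b c))) := fun a b c =>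
    (coeff_sumMap_of_lt Tt fun k hk =>
      coeff_bilinear_of_right_lt ℳ.r _ (fun k hk => hE k hk _ _) hk).trans
      (congrArg _ (coeff_bilinear_of_right ℳ.r _ fun k hk => hE k hk _ _))
  have hl' : ∀ a b c, coeff n (sumMap Tt (ℳ.series.l
      (defect ℳ.series (sumMap Tt) (sumMap Tt) b c) a)) = Tt 0 (ℳ.l
      (coeff n (defect ℳ.series (sumMap Tt) (sumMap Tt) b c)) (coeff 0 a)) := fun a b c =>
    (coeff_sumMap_of_lt Tt fun k hk =>
      coeff_bilinear_of_left_lt ℳ.l _ (fun k hk => hE k hk _ _) hk).trans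
      (congrArg _ (coeff_bilinear_of_left ℳ.l _ fun k hk => hE k hk _ _))
  have hφ : ∀ u, ℳ.series.φ (const u) = const (ℳ.φ u) := map_const ℳ.φ
  have hs : ∀ u v, coeff 0 (starT ℳ.series (sumMap Tt) (const u) (const v)) =
      starT ℳ (Tt 0) u v := fun u v => by
    simp [HomBimodule.series]
  simp only [coeff_add, coeff_sub, coeff_zero, hr, hl, hr', hl', hφ, coeff_sumMap_const,
    coeff_defect_const] at key
  -- In the two middle terms one argument is a ⋆-product for T_t, which is not a constant series; at
  -- order n only its constant term, the ⋆-product for T₀, matters.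
  rw [coeff_bilin_eq _ hB (starT ℳ.series (sumMap Tt) (const u) (const v)),
    coeff_bilin_eq _ hB (const (ℳ.φ u)), hs, hs, coeff_defect_const, coeff_defect_const,
    coeff_zero_const, coeff_zero_const] at key
  rw [← key, lT_apply, rT_apply]
  abel

/-! ### The differential in degrees 1 and 2 -/

/-- A bilinear map, seen as a map of two variables in the multilinear sense. -/
def toTwo (B : M →ₗ[R] M →ₗ[R] A) : MultilinearMap R (fun _ : Fin 2 => M) A :=
  MultilinearMap.mk' (fun u => B (u 0) (u 1))
    (fun u k x y => by fin_cases k <;> simp)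
    (fun u k c x => by fin_cases k <;> simp)

@[simp] theorem toTwo_apply (B : M →ₗ[R] M →ₗ[R] A) (u : Fin 2 → M) :
    toTwo B u = B (u 0) (u 1) := rfl

@[simp] theorem toOne_apply (f : M →ₗ[R] A) (u : Fin 1 → M) : toOne f u = f (u 0) := rfl

theorem dH_toOne (ℳ : HomBimodule 𝒜 M) (T S : M →ₗ[R] A) (u : Fin 2 → M) :
    dH ℳ T (toOne S) u = lT ℳ T (u 0) (S (u 1)) - S (starT ℳ T (u 0) (u 1))
      + rT ℳ T (S (u 0)) (u 1) := by
  rw [dH_apply]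
  simp [merge, Fin.tail, Fin.init, sub_eq_add_neg]

theorem dH_toTwo (ℳ : HomBimodule 𝒜 M) (T : M →ₗ[R] A) (B : M →ₗ[R] M →ₗ[R] A)
    (u : Fin 3 → M) :
    dH ℳ T (toTwo B) u = lT ℳ T (ℳ.φ (u 0)) (B (u 1) (u 2))
      - B (starT ℳ T (u 0) (u 1)) (ℳ.φ (u 2)) + B (ℳ.φ (u 0)) (starT ℳ T (u 1) (u 2))
      - rT ℳ T (B (u 0) (u 1)) (ℳ.φ (u 2)) := by
  rw [dH_apply, Fin.sum_univ_two]
  simp [merge, Fin.tail, Fin.init, sub_eq_add_neg, pow_succ]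
  abel

/-- If `H²(M, A) = 0`, then every `2`-cocycle is the coboundary of a `1`-cochain. -/
theorem exists_dH_eq (ℳ : HomBimodule 𝒜 M) {T : M →ₗ[R] A} (hT : IsOOperator ℳ T)
    [hH : Subsingleton (H2 ℳ hT)] {f : MultilinearMap R (fun _ : Fin 2 => M) A}
    (hf : f ∈ cochains ℳ 2) (hd : dH ℳ T f = 0) :
    ∃ S : M →ₗ[R] A, toOne S ∈ cochains ℳ 1 ∧ dH ℳ T (toOne S) = f := by
  have hc : (⟨f, hf⟩ : Cochain ℳ 2) ∈ cocycles ℳ hT 1 := Subtype.ext hd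
  have h0 : Submodule.Quotient.mk (p := (coboundaries ℳ hT 0).submoduleOf (cocycles ℳ hT 1))
      ⟨⟨f, hf⟩, hc⟩ = 0 := Subsingleton.elim (α := H2 ℳ hT) _ _
  rw [Submodule.Quotient.mk_eq_zero] at h0
  obtain ⟨c, hc⟩ := h0
  have hS : toOne ((MultilinearMap.ofSubsingleton R M A (0 : Fin 1)).symm c.1) = c.1 :=
    Equiv.apply_symm_apply _ _
  refine ⟨(MultilinearMap.ofSubsingleton R M A (0 : Fin 1)).symm c.1, ?_, ?_⟩
  · rw [hS]; exact c.2
  · rw [hS]; exact congrArg Subtype.val hc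

/-- Only the index pairs (0, n + 1) and (n + 1, 0) involve the new coefficient, and they contributed
nothing before because Tt (n + 1) = 0. Now they contribute defect(T₀, S) + defect(S, T₀), which is
exactly d_H S. -/
theorem curvature_add_single (ℳ : HomBimodule 𝒜 M) (Tt : ℕ → M →ₗ[R] A) (n : ℕ)
    (h0 : Tt (n + 1) = 0) (S : M →ₗ[R] A) (u : Fin 2 → M) :
    curvature ℳ (Tt + Pi.single (n + 1) S) (n + 1) (u 0) (u 1) =
      curvature ℳ Tt (n + 1) (u 0) (u 1) + dH ℳ (Tt 0) (toOne S) u := by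
  have h1 : (Tt + Pi.single (n + 1) S : ℕ → M →ₗ[R] A) 0 = Tt 0 := by simp
  have h2 : (Tt + Pi.single (n + 1) S : ℕ → M →ₗ[R] A) (n + 1) = S := by simp [h0]
  have h3 : ∀ i < n + 1, (Tt + Pi.single (n + 1) S : ℕ → M →ₗ[R] A) i = Tt i := fun i hi => by
    simp [hi.ne]
  rw [curvature_apply, curvature_apply, dH_toOne, Finset.Nat.sum_antidiagonal_succ,
    Finset.Nat.sum_antidiagonal_succ]
  -- For total degree 1 the two end pairs are all there is; from degree 2 on, a middle range with
  -- both indices positive must be split off and compared.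
  rcases n with _ | n
  · simp only [Finset.HasAntidiagonal.antidiagonal_zero, Finset.sum_singleton, h1, zero_add] at h2 h0 ⊢
    rw [h2, h0]
    simp [defect_apply]
    abel
  · rw [Finset.Nat.sum_antidiagonal_succ', Finset.Nat.sum_antidiagonal_succ', h1, h2, h0]
    have : ∀ x ∈ Finset.HasAntidiagonal.antidiagonal n,
        defect ℳ ((Tt + Pi.single (n + 1 + 1) S : ℕ → M →ₗ[R] A) (x.1 + 1))
          ((Tt + Pi.single (n + 1 + 1) S : ℕ → M →ₗ[R] A) (x.2 + 1)) (u 0) (u 1) =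
        defect ℳ (Tt (x.1 + 1)) (Tt (x.2 + 1)) (u 0) (u 1) := fun x hx => by
      rw [Finset.HasAntidiagonal.mem_antidiagonal] at hx
      rw [h3 _ (by omega), h3 _ (by omega)]
    rw [Finset.sum_congr rfl this]
    simp only [defect_apply, lT_apply, rT_apply, starT_apply, map_add, LinearMap.zero_apply,
      map_zero]
    abel

/-! ### Extending deformations order by order, and the formal limit -/

theorem isOrderDeformation_iff (ℳ : HomBimodule 𝒜 M) (T : M →ₗ[R] A) (n : ℕ)
    (Tt : ℕ → M →ₗ[R] A) :
    IsOrderDeformation ℳ T n Tt ↔ Tt 0 = T ∧ (∀ i, n < i → Tt i = 0) ∧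
      (∀ i, toOne (Tt i) ∈ cochains ℳ 1) ∧ ∀ k ≤ n, curvature ℳ Tt k = 0 := by
  have key : ∀ u v k, curvature ℳ Tt k u v = 0 ↔
      coeff k (𝒜.series.mul (sumMap Tt (const u)) (sumMap Tt (const v))) =
        coeff k (sumMap Tt (ℳ.series.l (sumMap Tt (const u)) (const v) +
          ℳ.series.r (const u) (sumMap Tt (const v)))) := fun u v k => by
    rw [← coeff_defect_const, defect_apply, coeff_sub, sub_eq_zero, add_comm (ℳ.series.r _ _)]
  refine ⟨fun h => ⟨h.1, h.2, h.3, fun k hk => ?_⟩,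
    fun h => ⟨h.1, h.2.1, h.2.2.1, fun u v k hk => ?_⟩⟩
  · ext u v
    exact (key u v k).2 (h.4 u v k hk)
  · rw [← key, h.2.2.2 k hk]
    rfl

theorem IsOrderDeformation.isExtendable {ℳ : HomBimodule 𝒜 M} {T : M →ₗ[R] A}
    (hT : IsOOperator ℳ T) [Subsingleton (H2 ℳ hT)] {n : ℕ} {Tt : ℕ → M →ₗ[R] A}
    (h : IsOrderDeformation ℳ T n Tt) : IsExtendable ℳ T n Tt := by
  obtain ⟨rfl, hn, hc, hE⟩ := (isOrderDeformation_iff ℳ T n Tt).1 h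
  -- The sign is chosen so that the change d_H S cancels the obstruction E_{n+1}.
  obtain ⟨S, hS, hdS⟩ := exists_dH_eq ℳ hT (f := toTwo (-curvature ℳ Tt (n + 1)))
    (fun u => by simp [curvature_φ ℳ hc])
    (by
      ext u
      rw [dH_toTwo]
      have := curvature_closed ℳ hc (n := n + 1) (fun k hk => hE k (by omega)) (u 0) (u 1) (u 2)
      rw [← neg_eq_zero] at this
      simp only [_root_.zero_apply, LinearMap.neg_apply, map_neg]
      rw [← this]
      abel)
  refine ⟨S, hS, (isOrderDeformation_iff _ _ _ _).2 ⟨by simp, fun i hi => ?_, fun i => ?_,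
    fun k hk => ?_⟩⟩
  · rw [Pi.add_apply, hn i (by omega), Pi.single_eq_of_ne (by omega), add_zero]
  · rw [Pi.add_apply]
    rcases eq_or_ne i (n + 1) with rfl | hi
    · rwa [hn _ (by omega), zero_add, Pi.single_eq_same]
    · rw [Pi.single_eq_of_ne hi, add_zero]
      exact hc i
  -- Up to order n the coefficients involved are untouched; at order n + 1 the obstruction is
  -- cancelled by d_H S.
  · rcases hk.lt_or_eq with hk | rfl
    · rw [curvature_congr ℳ (Tt' := Tt) fun i hi => by
        rw [Pi.add_apply, Pi.single_eq_of_ne (by omega), add_zero], hE k (by omega)]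
    · ext u v
      have := curvature_add_single ℳ Tt n (hn _ (by omega)) S ![u, v]
      rw [hdS] at this
      simpa using this

/-- The E_k test the defect on constant series only; R[[t]]-bilinearity, through
`coeff_bilin_eq_zero`, carries the vanishing to all of M[[t]]. -/
theorem isFormalDeformation_of_curvature {ℳ : HomBimodule 𝒜 M} {Tt : ℕ → M →ₗ[R] A}
    (hc : ∀ i, toOne (Tt i) ∈ cochains ℳ 1) (hE : ∀ k, curvature ℳ Tt k = 0) :
    IsFormalDeformation ℳ (Tt 0) Tt where
  zero_eq := rfl
  mem_cochains := hc
  isOOperator :=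
    { comm := sumMap_comm ℳ hc
      mul_eq := fun u v => by
        ext k
        have := coeff_bilin_eq_zero (defect ℳ.series (sumMap Tt) (sumMap Tt)) (n := k + 1)
          (fun j _ u v => by rw [coeff_defect_const, hE]; rfl) k (by omega) u v
        rwa [defect_apply, coeff_sub, sub_eq_zero, add_comm (ℳ.series.r _ _)] at this }

/-- A `1`-cocycle gives an order `1` deformation. -/
theorem isOrderDeformation_one {ℳ : HomBimodule 𝒜 M} {T : M →ₗ[R] A} (hT : IsOOperator ℳ T)
    {S : M →ₗ[R] A} (hS : toOne S ∈ cochains ℳ 1) (hd : dH ℳ T (toOne S) = 0) :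
    IsOrderDeformation ℳ T 1 (Pi.single 0 T + Pi.single 1 S) := by
  refine (isOrderDeformation_iff _ _ _ _).2 ⟨by simp, fun i hi => ?_, fun i => ?_, fun k hk => ?_⟩
  · simp [show i ≠ 0 by omega, show i ≠ 1 by omega]
  · rcases i with _ | _ | i
    · simpa using (toOne_mem_cochains ℳ T).2 hT.comm
    · simpa using hS
    · simpa using (toOne_mem_cochains ℳ (0 : M →ₗ[R] A)).2 (by simp)
  · have h0 : defect ℳ T T = 0 := by
      ext u v
      rw [defect_apply, hT.mul_eq, add_comm (ℳ.r _ _), sub_self]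
      rfl
    interval_cases k
    · simp [curvature, h0]
    · ext u v
      -- T + tS is viewed as the trivial order 0 deformation corrected in degree 1: the coefficient
      -- E₁ of the trivial one is zero, and the correction d_H S vanishes by `hd`.
      have := curvature_add_single ℳ (Pi.single 0 T) 0 (by simp) S ![u, v]
      simp only [Pi.single_eq_same, hd] at this
      simp only [zero_add, Matrix.cons_val_zero, Matrix.cons_val_one, Matrix.cons_val_fin_one,
        _root_.zero_apply, add_zero] at this
      rw [this, curvature_apply, Finset.Nat.sum_antidiagonal_succ]
      simp [defect_apply]

/-- If order `n` deformations always extend, every order `1` deformation extends to a formal one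
with the same infinitesimal. -/
theorem exists_isFormalDeformation {ℳ : HomBimodule 𝒜 M} {T : M →ₗ[R] A}
    (hext : ∀ n Tt, IsOrderDeformation ℳ T n Tt → IsExtendable ℳ T n Tt)
    {Tt : ℕ → M →ₗ[R] A} (h : IsOrderDeformation ℳ T 1 Tt) :
    ∃ Tt' : ℕ → M →ₗ[R] A, IsFormalDeformation ℳ T Tt' ∧ Tt' 1 = Tt 1 := by
  choose S _ hS using hext
  -- Stage n has order n + 1, since the construction starts from order 1; passing to the next stage
  -- only changes the coefficient at index n + 2.
  let D : ∀ n, {F : ℕ → M →ₗ[R] A // IsOrderDeformation ℳ T (n + 1) F} := fun n =>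
    Nat.rec ⟨Tt, h⟩ (fun n F => ⟨_, hS (n + 1) F.1 F.2⟩) n
  have hstep : ∀ n i, i ≤ n + 1 → (D (n + 1)).1 i = (D n).1 i := fun n i hi => by
    change ((D n).1 + Pi.single (n + 1 + 1) _ : ℕ → M →ₗ[R] A) i = _
    rw [Pi.add_apply, Pi.single_eq_of_ne (by omega), add_zero]
  have hstab : ∀ i m, i ≤ m → (D m).1 i = (D i).1 i := fun i m hm => by
    induction m, hm using Nat.le_induction with
    | base => rfl
    | succ m hm ih => rw [hstep m i (by omega), ih]
  have hD := fun n => (isOrderDeformation_iff ℳ T _ _).1 (D n).2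
  -- The limit is the diagonal sequence. Its E_k depends only on coefficients of index at most k,
  -- where it agrees with stage k, a deformation of order k + 1.
  have key := isFormalDeformation_of_curvature (ℳ := ℳ) (Tt := fun i => (D i).1 i)
    (fun i => (hD i).2.2.1 i) fun k => by
      rw [curvature_congr ℳ fun i hi => (hstab i k hi).symm]
      exact (hD k).2.2.2 k (by omega)
  refine ⟨fun i => (D i).1 i, ?_, hstep 0 1 le_rfl⟩
  rwa [(hD 0).1] at key

end Obstruction

end HomDeform

theorem mainTheorem9 {K A M : Type*} [Field K] [AddCommGroup A] [Module K A]
    [AddCommGroup M] [Module K M] (𝒜 : HomDeform.HomAssocAlgebra K A)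
    (ℳ : HomDeform.HomBimodule 𝒜 M) (T : M →ₗ[K] A) (hT : HomDeform.IsOOperator ℳ T)
    (hH : Subsingleton (HomDeform.H2 ℳ hT)) :
    (∀ (n : ℕ) (Tt : ℕ → M →ₗ[K] A), HomDeform.IsOrderDeformation ℳ T n Tt →
      HomDeform.IsExtendable ℳ T n Tt) ∧
    (∀ c : HomDeform.Cochain ℳ 1, c ∈ HomDeform.Z1 ℳ hT →
      ∃ Tt : ℕ → M →ₗ[K] A, HomDeform.IsFormalDeformation ℳ T Tt ∧
        HomDeform.toOne (Tt 1) = c.1) := by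
  have hext : ∀ (n : ℕ) (Tt : ℕ → M →ₗ[K] A), HomDeform.IsOrderDeformation ℳ T n Tt →
      HomDeform.IsExtendable ℳ T n Tt := fun n Tt h => h.isExtendable hT
  refine ⟨hext, fun c hc => ?_⟩
  -- A 1-cochain is a multilinear map in one variable; the deformation needs the underlying linear
  -- map.
  let S : M →ₗ[K] A := (MultilinearMap.ofSubsingleton K M A (0 : Fin 1)).symm c.1
  have hS : HomDeform.toOne S = c.1 := Equiv.apply_symm_apply _ _
  have hd : HomDeform.dH ℳ T c.1 = 0 := congrArg Subtype.val hc
  obtain ⟨Tt, h, h1⟩ := HomDeform.exists_isFormalDeformation hext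
    (HomDeform.isOrderDeformation_one hT (S := S) (hS ▸ c.2) (hS ▸ hd))
  refine ⟨Tt, h, ?_⟩
  rw [h1, ← hS]
  simp
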